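/- **Conventions.** Let $(X,d)$ be a compact metric space and $f:X\to X$ continuous. *Emergent order spectrum.* An $\varepsilon$-chain from $x$ to $y$ is a finite sequence $x_0=x,x_1,\dots,x_m=y$ with $m\ge 1$ and $d(f(x_i),x_{i+1})<\varepsilon$ for $0\le i<m$; its support is $\{x_0,\dots,x_m\}$. It is acyclic if $x_1,\dots,x_{m-1}$ are pairwise distinct and different from $x_0$ and $x_m$. A complete sequence of ordinately nested chains from $x$ to $y$ is a sequence $(S_n)$ of acyclic $\varepsilon_n$-chains from $x$ to $y$, with $\varepsilon_n>0$ decreasing monotonically to $0$, whose supports are nested increasingly with union $S$, and such that for any two distinct $z,w\in S\setminus\{x,y\}$ either $z$ appears before $w$ in $S_n$ for all large $n$, or $w$ appears before $z$ in $S_n$ for all large $n$. This defines a limit linear order $\le_\infty$ on $S\setminus\{x,y\}$: $z\le_\infty w$ iff $z=w$ or $z$ appears before $w$ in $S_n$ for all large $n$. $\Omega(x,y)$ is the set of the order types of $(S\setminus\{x,y\},\le_\infty)$ over all such sequences. $\omega$, $\omega^*$ and $\zeta$ denote the order types of $\mathbb N$, of $\mathbb N$ reversed, and of $\mathbb Z$;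 $\zeta\cdot\omega$ is the sum of $\omega$ copies of $\zeta$. *Prolongational sets.* $J_1(x)$ is the set of all $y$ such that for every $\varepsilon>0$ there are $z\in B_\varepsilon(x)$ and $k\ge1$ with $f^k(z)\in B_\varepsilon(y)$. For an ordinal $\alpha>1$, $$J_\alpha(x)=\bigcap_{\varepsilon>0}\overline{\bigcup_{n\ge1}\ \bigcup_{1\le\beta<\alpha}(J_\beta)^n(B_\varepsilon(x))},$$ where $J_\beta(A)=\bigcup_{a\in A}J_\beta(a)$, and $(J_\beta)^n$ is the $n$-fold iterate of $A\mapsto J_\beta(A)$. **Theorem.** There exist a compact metric space $X$, a continuous map $f:X\to X$, points $x_1,x_2,x_3\in X$ and an ordinal $\alpha\ge 1$ such that $$\alpha=\min\{\beta\ge1\mid x_2\in J_\beta(x_1)\}=\min\{\beta\ge1\mid x_3\in J_\beta(x_1)\}\qquad\text{and}\qquad \Omega(x_1,x_2)\neq\Omega(x_1,x_3).$$ Explicitly, let $X=[-1,1]$ and $$f(x)=\begin{cases}2^{-\lfloor\log_2x\rfloor}\bigl(x-2^{\lfloor\log_2x\rfloor}\bigr)^2+2^{\lfloor\log_2x\rfloor}&\text{if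 }0<x\le1,\\ (x+1)^2-1&\text{if }-1\le x\le0.\end{cases}$$ Then $f$ is a continuous map $X\to X$, and for $x_1=1$, $x_2=-1$ and every $x_3\in(-1,0)$ one has $x_2,x_3\in J_3(x_1)\setminus J_2(x_1)$, with $\alpha=3$ the minimum of both sets above, and $$\zeta\cdot\omega+\zeta\in\Omega(x_1,x_2)\setminus\Omega(x_1,x_3),\qquad \zeta\cdot\omega+\omega^*\in\Omega(x_1,x_3)\setminus\Omega(x_1,x_2),$$ so that $\Omega(x_1,x_2)\neq\Omega(x_1,x_3)$. -/

import Mathlib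

namespace EOS

section Chains

variable {X : Type*} [MetricSpace X]

/-- An `ε`-chain `x₀, …, x_m` (with `m = len ≥ 1`) of `f` from `x` to `y`.
Only the values `pt 0, …, pt len` are meaningful; the other values of `pt` are never used. -/
structure EpsChain (f : X → X) (ε : ℝ) (x y : X) where
  len : ℕ
  one_le_len : 1 ≤ len
  pt : ℕ → X
  pt_zero : pt 0 = x
  pt_len : pt len = y
  step : ∀ i < len, dist (f (pt i)) (pt (i + 1)) < ε

namespace EpsChain

variable {f : X → X} {ε : ℝ} {x y : X}

/-- The support `{x₀, …, x_m}` of a chain. -/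
def support (C : EpsChain f ε x y) : Set X := {z | ∃ i ≤ C.len, C.pt i = z}

/-- A chain is acyclic if its interior points `x₁, …, x_{m-1}` are pairwise distinct and
different from both end points. -/
def Acyclic (C : EpsChain f ε x y) : Prop :=
  (∀ i j, 0 < i → i < C.len → 0 < j → j < C.len → i ≠ j → C.pt i ≠ C.pt j) ∧
  (∀ i, 0 < i → i < C.len → C.pt i ≠ C.pt 0 ∧ C.pt i ≠ C.pt C.len)

/-- `z` appears before `w` in the chain. -/
def Before (C : EpsChain f ε x y) (z w : X) : Prop :=
  ∃ i j, i < j ∧ j ≤ C.len ∧ C.pt i = z ∧ C.pt j = w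

/-- The order given by the indices of the chain (used for acyclic chains and for points other
than the end points, which occupy at most one position). -/
def Le (C : EpsChain f ε x y) (z w : X) : Prop :=
  ∃ i j, i ≤ j ∧ j ≤ C.len ∧ C.pt i = z ∧ C.pt j = w

end EpsChain

variable {f : X → X} {ε : ℕ → ℝ} {x y : X}

/-- The union `S` of the supports of a sequence of chains. -/
def totalSupport (C : ∀ n, EpsChain f (ε n) x y) : Set X := ⋃ n, (C n).support

/-- A complete sequence of ordinately nested chains: `ε n > 0` decreases to `0`, the supports are
nested, the chains are acyclic, and any two distinct points of the union of the supports, other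
than `x` and `y`, eventually appear in the chains in a constant order. -/
structure OrdinatelyNested (C : ∀ n, EpsChain f (ε n) x y) : Prop where
  pos : ∀ n, 0 < ε n
  anti : Antitone ε
  tendsto : Filter.Tendsto ε Filter.atTop (nhds 0)
  nested : ∀ n, (C n).support ⊆ (C (n + 1)).support
  acyclic : ∀ n, (C n).Acyclic
  compatible : ∀ z ∈ totalSupport C \ {x, y}, ∀ w ∈ totalSupport C \ {x, y}, z ≠ w →
    Xor (∃ N, ∀ n > N, (C n).Before z w) (∃ N, ∀ n > N, (C n).Before w z)

/-- The limit order `≤_∞` on `S \ {x, y}`. -/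
def limitLE (C : ∀ n, EpsChain f (ε n) x y) (z w : ↥(totalSupport C \ {x, y})) : Prop :=
  ∃ N, ∀ n ≥ N, (C n).Le z w

/-- The emergent order spectrum `Ω_f(x, y)`: the set of the order types of `(S \ {x, y}, ≤_∞)` over
all complete sequences of ordinately nested chains from `x` to `y`. (`S` is countable, so these
order types are all represented in `Type`.) -/
def spectrum (f : X → X) (x y : X) : Set OrderType.{0} :=
  {β | ∃ (ε : ℕ → ℝ) (C : ∀ n, EpsChain f (ε n) x y), OrdinatelyNested C ∧
    Nonempty (limitLE C ≃r ((· ≤ ·) : β.ToType → β.ToType → Prop))}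

end Chains

section Prolongations

variable {X : Type*} [MetricSpace X]

/-- The non-wandering relation `x 𝒩 y`. -/
def NonWandering (f : X → X) (x y : X) : Prop :=
  ∀ ε > 0, ∃ z ∈ Metric.ball x ε, ∃ k ≥ 1, f^[k] z ∈ Metric.ball y ε

/-- The image `R(A) = ⋃_{a ∈ A} R(a)` of a set under a set-valued map. -/
def setImage (R : X → Set X) (A : Set X) : Set X := ⋃ a ∈ A, R a

/-- Auslander's prolongational sets `J_α(x)`, indexed by the ordinals `α ≥ 1`:
`J_1(x) = {y | x 𝒩 y}` and, for `α > 1`, `J_α(x)` is the intersection over `ε > 0` of the closures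
of `⋃_{n ≥ 1} ⋃_{1 ≤ β < α} (J_β)^n (B_ε(x))`. (The value at `α = 0` is empty and irrelevant.) -/
noncomputable def prolongation (f : X → X) (α : Ordinal.{0}) (x : X) : Set X :=
  open Classical in
  if α = 1 then {y | NonWandering f x y}
  else ⋂ (ε : ℝ) (_ : 0 < ε), closure (⋃ (n : ℕ) (_ : 1 ≤ n) (β : Ordinal.{0}) (_ : 1 ≤ β)
    (_ : β < α), (setImage (fun z => prolongation f β z))^[n] (Metric.ball x ε))
termination_by α

theorem prolongation_one (f : X → X) (x : X) : prolongation f 1 x = {y | NonWandering f x y} := by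
  rw [prolongation, if_pos rfl]

theorem prolongation_of_ne_one (f : X → X) {α : Ordinal.{0}} (hα : α ≠ 1) (x : X) :
    prolongation f α x = ⋂ (ε : ℝ) (_ : 0 < ε), closure (⋃ (n : ℕ) (_ : 1 ≤ n) (β : Ordinal.{0})
      (_ : 1 ≤ β) (_ : β < α), (setImage (prolongation f β))^[n] (Metric.ball x ε)) := by
  rw [prolongation, if_neg hα]

end Prolongations

section Example

/-- The piecewise quadratic formula. On `x > 0` it is
`2^{-k} (x - 2^k)^2 + 2^k` with `k = ⌊log₂ x⌋`; at `x = 0` its value is `0`. -/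
noncomputable def quadFormula (x : ℝ) : ℝ :=
  if 0 < x then
    (2 : ℝ) ^ (-⌊Real.logb 2 x⌋) * (x - (2 : ℝ) ^ ⌊Real.logb 2 x⌋) ^ 2
      + (2 : ℝ) ^ ⌊Real.logb 2 x⌋
  else (x + 1) ^ 2 - 1

theorem quadFormula_mem {x : ℝ} (hx : x ∈ Set.Icc (-1 : ℝ) 1) :
    quadFormula x ∈ Set.Icc (-1 : ℝ) 1 := by
  obtain ⟨h1, h2⟩ := hx
  unfold quadFormula
  split_ifs with h
  · have hlow : (2 : ℝ) ^ ⌊Real.logb 2 x⌋ ≤ x := by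
      have := (Real.le_logb_iff_rpow_le one_lt_two h).1 (Int.floor_le (Real.logb 2 x))
      rwa [Real.rpow_intCast] at this
    have hup : x < (2 : ℝ) ^ ⌊Real.logb 2 x⌋ * 2 := by
      have := (Real.logb_lt_iff_lt_rpow one_lt_two h).1 (Int.lt_floor_add_one (Real.logb 2 x))
      rw [Real.rpow_add two_pos, Real.rpow_intCast, Real.rpow_one] at this
      exact this
    rw [zpow_neg]
    have hp : (0 : ℝ) < (2 : ℝ) ^ ⌊Real.logb 2 x⌋ := by positivity
    generalize (2 : ℝ) ^ ⌊Real.logb 2 x⌋ = p at *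
    have hle : p⁻¹ * (x - p) ^ 2 ≤ x - p := by
      rw [inv_mul_le_iff₀ hp]
      nlinarith
    have hge : 0 ≤ p⁻¹ * (x - p) ^ 2 := by positivity
    constructor <;> linarith
  · constructor <;> nlinarith

/-- The piecewise quadratic self-map of the interval `[-1, 1]`. -/
noncomputable def quadMap (x : Set.Icc (-1 : ℝ) 1) : Set.Icc (-1 : ℝ) 1 :=
  ⟨quadFormula x, quadFormula_mem x.2⟩

end Example

/-- The order type `ω` of the natural numbers. -/
noncomputable def omegaType : OrderType.{0} := OrderType.type ℕ

/-- The reverse order type `ω*` of `ω`. -/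
noncomputable def omegaStar : OrderType.{0} := OrderType.type ℕᵒᵈ

/-- The order type `ζ` of the integers. -/
noncomputable def zeta : OrderType.{0} := OrderType.type ℤ

end EOS

/-! The map fixes `0`, `-1` and every `2 ^ (-k)`. On each dyadic interval, and on `[-1, 0]`, it is
an affine copy of squaring on `[0, 1]`, so orbits descend from one fixed point to the next: from `1`
through the points `2 ^ (-k)` towards `0`, and from `0` to `-1`.

Prolongations. The points at or above `2 ^ k` form an invariant set, so iterates of `J_1` starting
near `1` stay positive and `J_2 (1)` contains no negative point (`nonneg_of_mem_prolongation_two`).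
Following the fixed points shows `0 ∈ J_2 (1)`, and `J_1 (0)` contains every negative point. Two
iterates of `J_2` thus lead from `1` to any negative point, which therefore lies in `J_3 (1)`.

Spectra. The two targets are told apart by whether the limit order has a maximum. If `y ∈ (-1, 0)`,
fine chains must all enter `y` from the same point, which is a maximum (`exists_limitLE_max`). If `y
= -1`, chains approach `y` through points ever closer to it and there is no maximum
(`not_exists_limitLE_max`). Both order types are realized by truncating full orbits in all the
dyadic intervals, followed by an orbit in `(-1, 0)` (`type_sum_mem_spectrum`): a full orbit for the
target `-1`, the backward orbit of `y` for `y ∈ (-1, 0)`. -/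

namespace EOS

/-! ### Realizing an order type by finite chains -/

section Realization

variable {X I : Type*} [LinearOrder I]

/-- The sequence `x, φ i₁, …, φ iᵣ, y, y, …`, where `i₁ < … < iᵣ` are the elements of `F`. -/
noncomputable def chainPt (F : Finset I) (φ : I → X) (x y : X) : ℕ → X
  | 0 => x
  | i + 1 => if h : i < F.card then φ (F.orderEmbOfFin rfl ⟨i, h⟩) else y

variable {F : Finset I} {φ : I → X} {x y : X}

theorem chainPt_succ_of_lt {i : ℕ} (h : i < F.card) :
    chainPt F φ x y (i + 1) = φ (F.orderEmbOfFin rfl ⟨i, h⟩) := dif_pos h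

theorem chainPt_succ_of_le {i : ℕ} (h : F.card ≤ i) : chainPt F φ x y (i + 1) = y :=
  dif_neg h.not_gt

theorem chainPt_eq_apply_iff (hφ : Function.Injective φ) (hx : ∀ i, φ i ≠ x) (hy : ∀ i, φ i ≠ y)
    {m : ℕ} {a : I} : chainPt F φ x y m = φ a ↔
      ∃ (k : ℕ) (h : k < F.card), m = k + 1 ∧ F.orderEmbOfFin rfl ⟨k, h⟩ = a := by
  constructor
  · intro h
    cases m with
    | zero => exact absurd h.symm (hx a)
    | succ k =>
      by_cases hk : k < F.card
      · rw [chainPt_succ_of_lt hk] at h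
        exact ⟨k, hk, rfl, hφ h⟩
      · rw [chainPt_succ_of_le (not_lt.1 hk)] at h
        exact absurd h.symm (hy a)
  · rintro ⟨k, hk, rfl, rfl⟩
    exact chainPt_succ_of_lt hk

theorem exists_orderEmbOfFin_eq {a : I} (ha : a ∈ F) :
    ∃ (k : ℕ) (h : k < F.card), F.orderEmbOfFin rfl ⟨k, h⟩ = a := by
  have : a ∈ Set.range (F.orderEmbOfFin rfl) := by rwa [F.range_orderEmbOfFin rfl]
  obtain ⟨⟨k, hk⟩, h⟩ := this
  exact ⟨k, hk, h⟩

variable [MetricSpace X] {f : X → X} {ε : ℝ}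

/-- The chain through the points `φ i`, `i ∈ F`, visited in increasing order of `i`. -/
noncomputable def chainOfFinset (hF : F.Nonempty)
    (hfirst : ∀ i ∈ F, (∀ j ∈ F, i ≤ j) → dist (f x) (φ i) < ε)
    (hstep : ∀ i ∈ F, ∀ j ∈ F, i < j → (∀ l ∈ F, l ≤ i ∨ j ≤ l) → dist (f (φ i)) (φ j) < ε)
    (hlast : ∀ i ∈ F, (∀ j ∈ F, j ≤ i) → dist (f (φ i)) y < ε) : EpsChain f ε x y where
  len := F.card + 1
  one_le_len := Nat.le_add_left 1 _
  pt := chainPt F φ x y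
  pt_zero := rfl
  pt_len := chainPt_succ_of_le le_rfl
  step := by
    intro m hm
    cases m with
    | zero =>
      rw [chainPt_succ_of_lt hF.card_pos]
      refine hfirst _ (F.orderEmbOfFin_mem rfl _) fun j hj => ?_
      obtain ⟨k, hk, rfl⟩ := exists_orderEmbOfFin_eq hj
      exact (F.orderEmbOfFin rfl).monotone (Fin.mk_le_mk.2 k.zero_le)
    | succ m =>
      have hm' : m < F.card := by omega
      rw [chainPt_succ_of_lt hm']
      by_cases h : m + 1 < F.card
      · rw [chainPt_succ_of_lt h]
        refine hstep _ (F.orderEmbOfFin_mem rfl _) _ (F.orderEmbOfFin_mem rfl _)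
          ((F.orderEmbOfFin rfl).strictMono (Fin.mk_lt_mk.2 m.lt_succ_self)) fun l hl => ?_
        obtain ⟨k, hk, rfl⟩ := exists_orderEmbOfFin_eq hl
        rcases le_or_gt k m with h1 | h1
        · exact .inl ((F.orderEmbOfFin rfl).monotone (Fin.mk_le_mk.2 h1))
        · exact .inr ((F.orderEmbOfFin rfl).monotone (Fin.mk_le_mk.2 h1))
      · rw [chainPt_succ_of_le (not_lt.1 h)]
        refine hlast _ (F.orderEmbOfFin_mem rfl _) fun j hj => ?_
        obtain ⟨k, hk, rfl⟩ := exists_orderEmbOfFin_eq hj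
        exact (F.orderEmbOfFin rfl).monotone (Fin.mk_le_mk.2 (by omega))

end Realization

/-- An order type is realized in the spectrum by an injective family of points indexed by it,
together with an exhaustion by finite sets along which the points form chains. -/
theorem type_mem_spectrum {X : Type*} [MetricSpace X] {f : X → X} {x y : X} {I : Type}
    [LinearOrder I] {φ : I → X} (hφ : Function.Injective φ) (hx : ∀ i, φ i ≠ x)
    (hy : ∀ i, φ i ≠ y) {F : ℕ → Finset I} (hF : Monotone F) (hne : ∀ n, (F n).Nonempty)
    (hex : ∀ i, ∃ n, i ∈ F n) {ε : ℕ → ℝ} (hpos : ∀ n, 0 < ε n) (hanti : Antitone ε)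
    (hlim : Filter.Tendsto ε Filter.atTop (nhds 0))
    (hfirst : ∀ n, ∀ i ∈ F n, (∀ j ∈ F n, i ≤ j) → dist (f x) (φ i) < ε n)
    (hstep : ∀ n, ∀ i ∈ F n, ∀ j ∈ F n, i < j → (∀ l ∈ F n, l ≤ i ∨ j ≤ l) →
      dist (f (φ i)) (φ j) < ε n)
    (hlast : ∀ n, ∀ i ∈ F n, (∀ j ∈ F n, j ≤ i) → dist (f (φ i)) y < ε n) :
    OrderType.type I ∈ spectrum f x y := by
  let C : ∀ n, EpsChain f (ε n) x y := fun n =>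
    chainOfFinset (hne n) (hfirst n) (hstep n) (hlast n)
  -- Since `φ` is injective and avoids both end points, `φ a` can only sit at the position given by
  -- the rank of `a` in `F n`. Chain order is therefore index order.
  have hiff : ∀ n m a, (C n).pt m = φ a ↔
      ∃ (k : ℕ) (h : k < (F n).card), m = k + 1 ∧ (F n).orderEmbOfFin rfl ⟨k, h⟩ = a :=
    fun n m a => chainPt_eq_apply_iff hφ hx hy
  have hlen : ∀ n, (C n).len = (F n).card + 1 := fun _ => rfl
  have hLe : ∀ n a b, (C n).Le (φ a) (φ b) ↔ a ∈ F n ∧ b ∈ F n ∧ a ≤ b := by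
    intro n a b
    constructor
    · rintro ⟨i, j, hij, -, h1, h2⟩
      obtain ⟨k, hk, rfl, rfl⟩ := (hiff _ _ _).1 h1
      obtain ⟨l, hl, rfl, rfl⟩ := (hiff _ _ _).1 h2
      exact ⟨Finset.orderEmbOfFin_mem _ _ _, Finset.orderEmbOfFin_mem _ _ _,
        OrderEmbedding.monotone _ (Fin.mk_le_mk.2 (by omega))⟩
    · rintro ⟨ha, hb, hab⟩
      obtain ⟨k, hk, rfl⟩ := exists_orderEmbOfFin_eq ha
      obtain ⟨l, hl, rfl⟩ := exists_orderEmbOfFin_eq hb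
      have := Fin.mk_le_mk.1 ((OrderEmbedding.le_iff_le _).1 hab)
      exact ⟨k + 1, l + 1, by omega, by rw [hlen]; omega, (hiff _ _ _).2 ⟨k, hk, rfl, rfl⟩,
        (hiff _ _ _).2 ⟨l, hl, rfl, rfl⟩⟩
  have hBefore : ∀ n a b, (C n).Before (φ a) (φ b) ↔ a ∈ F n ∧ b ∈ F n ∧ a < b := by
    intro n a b
    constructor
    · rintro ⟨i, j, hij, -, h1, h2⟩
      obtain ⟨k, hk, rfl, rfl⟩ := (hiff _ _ _).1 h1
      obtain ⟨l, hl, rfl, rfl⟩ := (hiff _ _ _).1 h2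
      exact ⟨Finset.orderEmbOfFin_mem _ _ _, Finset.orderEmbOfFin_mem _ _ _,
        OrderEmbedding.strictMono _ (Fin.mk_lt_mk.2 (by omega))⟩
    · rintro ⟨ha, hb, hab⟩
      obtain ⟨k, hk, rfl⟩ := exists_orderEmbOfFin_eq ha
      obtain ⟨l, hl, rfl⟩ := exists_orderEmbOfFin_eq hb
      have := Fin.mk_lt_mk.1 ((OrderEmbedding.lt_iff_lt _).1 hab)
      exact ⟨k + 1, l + 1, by omega, by rw [hlen]; omega, (hiff _ _ _).2 ⟨k, hk, rfl, rfl⟩,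
        (hiff _ _ _).2 ⟨l, hl, rfl, rfl⟩⟩
  have hpt : ∀ n m, (C n).pt m = x ∨ (C n).pt m = y ∨ ∃ a ∈ F n, (C n).pt m = φ a := by
    intro n m
    cases m with
    | zero => exact .inl rfl
    | succ k =>
      by_cases hk : k < (F n).card
      · exact .inr (.inr ⟨_, Finset.orderEmbOfFin_mem _ rfl _, chainPt_succ_of_lt (x := x) hk⟩)
      · exact .inr (.inl (chainPt_succ_of_le (x := x) (not_lt.1 hk)))
  have hsupp : ∀ n, (C n).support = {x, y} ∪ φ '' (F n : Set I) := by
    intro n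
    ext z
    constructor
    · rintro ⟨m, -, rfl⟩
      rcases hpt n m with h | h | ⟨a, ha, h⟩
      · exact .inl (.inl h)
      · exact .inl (.inr h)
      · exact .inr ⟨a, ha, h.symm⟩
    · rintro ((rfl | rfl) | ⟨a, ha, rfl⟩)
      · exact ⟨0, Nat.zero_le _, rfl⟩
      · exact ⟨(C n).len, le_rfl, (C n).pt_len⟩
      · obtain ⟨k, hk, rfl⟩ := exists_orderEmbOfFin_eq ha
        exact ⟨k + 1, by rw [hlen]; omega, (hiff _ _ _).2 ⟨k, hk, rfl, rfl⟩⟩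
  have hmem : ∀ z, z ∈ totalSupport C \ {x, y} ↔ ∃ a, φ a = z := by
    intro z
    constructor
    · rintro ⟨hz, hz'⟩
      obtain ⟨n, hn⟩ := Set.mem_iUnion.1 hz
      rw [hsupp] at hn
      rcases hn with hn | ⟨a, -, rfl⟩
      · exact absurd hn hz'
      · exact ⟨a, rfl⟩
    · rintro ⟨a, rfl⟩
      obtain ⟨n, hn⟩ := hex a
      refine ⟨Set.mem_iUnion.2 ⟨n, ?_⟩, ?_⟩
      · rw [hsupp]
        exact .inr ⟨a, hn, rfl⟩
      · rintro (h | h)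
        · exact hx a h
        · exact hy a h
  have hint : ∀ n m, 0 < m → m < (C n).len → ∃ (k : ℕ) (h : k < (F n).card), m = k + 1 ∧
      (C n).pt m = φ ((F n).orderEmbOfFin rfl ⟨k, h⟩) := by
    intro n m h0 h1
    obtain ⟨k, rfl⟩ := Nat.exists_eq_add_of_lt h0
    rw [hlen] at h1
    have hk : k < (F n).card := by omega
    rw [zero_add]
    exact ⟨k, hk, rfl, chainPt_succ_of_lt (x := x) hk⟩
  have hev : ∀ a b, ∃ N, ∀ n ≥ N, a ∈ F n ∧ b ∈ F n := by
    intro a b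
    obtain ⟨n, hn⟩ := hex a
    obtain ⟨m, hm⟩ := hex b
    exact ⟨max n m, fun k hk => ⟨hF ((le_max_left _ _).trans hk) hn,
      hF ((le_max_right _ _).trans hk) hm⟩⟩
  have hlimit : ∀ a b, (∃ N, ∀ n ≥ N, (C n).Le (φ a) (φ b)) ↔ a ≤ b := by
    intro a b
    constructor
    · rintro ⟨N, hN⟩
      exact ((hLe _ _ _).1 (hN N le_rfl)).2.2
    · intro hab
      obtain ⟨N, hN⟩ := hev a b
      exact ⟨N, fun n hn => (hLe _ _ _).2 ⟨(hN n hn).1, (hN n hn).2, hab⟩⟩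
  have hlimit' : ∀ a b, (∃ N, ∀ n > N, (C n).Before (φ a) (φ b)) ↔ a < b := by
    intro a b
    constructor
    · rintro ⟨N, hN⟩
      exact ((hBefore _ _ _).1 (hN (N + 1) N.lt_succ_self)).2.2
    · intro hab
      obtain ⟨N, hN⟩ := hev a b
      exact ⟨N, fun n hn => (hBefore _ _ _).2 ⟨(hN n hn.le).1, (hN n hn.le).2, hab⟩⟩
  refine ⟨ε, C, ⟨hpos, hanti, hlim, fun n => ?_, fun n => ⟨?_, ?_⟩, ?_⟩, ?_⟩
  · rw [hsupp, hsupp]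
    exact Set.union_subset_union_right _ (Set.image_mono (Finset.coe_subset.2 (hF n.le_succ)))
  · intro i j hi hi' hj hj' hij h
    obtain ⟨k, hk, rfl, hk'⟩ := hint n i hi hi'
    obtain ⟨l, hl, rfl, hl'⟩ := hint n j hj hj'
    rw [hk', hl'] at h
    have := Fin.mk.inj_iff.1 ((OrderEmbedding.strictMono _).injective (hφ h))
    omega
  · intro i hi hi'
    obtain ⟨k, hk, rfl, hk'⟩ := hint n i hi hi'
    rw [hk', (C n).pt_zero, (C n).pt_len]
    exact ⟨hx _, hy _⟩
  · intro z hz w hw hzw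
    obtain ⟨a, rfl⟩ := (hmem z).1 hz
    obtain ⟨b, rfl⟩ := (hmem w).1 hw
    rw [hlimit', hlimit']
    rcases lt_or_gt_of_ne (fun h => hzw (congrArg φ h) : a ≠ b) with h | h
    · exact .inl ⟨h, h.not_gt⟩
    · exact .inr ⟨h, h.not_gt⟩
  · obtain ⟨e⟩ := OrderType.type_eq_type.1 (OrderType.type_toType (OrderType.type I))
    let g : I ≃ ↥(totalSupport C \ {x, y}) :=
      Equiv.ofBijective (fun a => ⟨φ a, (hmem _).2 ⟨a, rfl⟩⟩)
        ⟨fun a b h => hφ (congrArg Subtype.val h), fun ⟨z, hz⟩ =>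
          let ⟨a, ha⟩ := (hmem z).1 hz
          ⟨a, Subtype.ext ha⟩⟩
    exact ⟨((⟨g, fun {a b} => hlimit a b⟩ : ((· ≤ ·) : I → I → Prop) ≃r limitLE C).symm).trans
      e.symm⟩

/-! ### Dynamics and continuity of the map -/

section Dynamics

theorem quadFormula_of_nonpos {x : ℝ} (hx : x ≤ 0) : quadFormula x = (x + 1) ^ 2 - 1 :=
  if_neg hx.not_gt

theorem quadFormula_zero : quadFormula 0 = 0 := by
  rw [quadFormula_of_nonpos le_rfl]; norm_num

theorem floor_logb_two_eq {x : ℝ} {k : ℤ} (h1 : (2 : ℝ) ^ k ≤ x) (h2 : x < (2 : ℝ) ^ (k + 1)) :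
    ⌊Real.logb 2 x⌋ = k := by
  have hx : 0 < x := lt_of_lt_of_le (by positivity) h1
  rw [Int.floor_eq_iff]
  constructor
  · rw [Real.le_logb_iff_rpow_le one_lt_two hx, Real.rpow_intCast]
    exact h1
  · rw [Real.logb_lt_iff_lt_rpow one_lt_two hx, ← Int.cast_one, ← Int.cast_add,
      Real.rpow_intCast]
    exact h2

theorem exists_dyadic {x : ℝ} (hx : 0 < x) : ∃ k : ℤ, (2 : ℝ) ^ k ≤ x ∧ x < (2 : ℝ) ^ (k + 1) := by
  obtain ⟨k, hk⟩ := exists_mem_Ico_zpow hx one_lt_two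
  exact ⟨k, hk⟩

theorem zpow_two_add_one (k : ℤ) : (2 : ℝ) ^ (k + 1) = 2 ^ k * 2 := zpow_add_one₀ two_ne_zero k

theorem quadFormula_zpow_mul_of_lt (k : ℤ) {u : ℝ} (h0 : 0 ≤ u) (h1 : u < 1) :
    quadFormula (2 ^ k * (1 + u)) = 2 ^ k * (1 + u ^ 2) := by
  have hp : (0 : ℝ) < 2 ^ k := by positivity
  have hfl : ⌊Real.logb 2 (2 ^ k * (1 + u))⌋ = k := by
    refine floor_logb_two_eq ?_ ?_
    · nlinarith
    · rw [zpow_two_add_one]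
      nlinarith
  rw [quadFormula, if_pos (by positivity), hfl, zpow_neg]
  field_simp
  ring

/-- On each dyadic interval the map is conjugate to squaring on `[0, 1]`. -/
theorem quadFormula_zpow_mul (k : ℤ) {u : ℝ} (h0 : 0 ≤ u) (h1 : u ≤ 1) :
    quadFormula (2 ^ k * (1 + u)) = 2 ^ k * (1 + u ^ 2) := by
  rcases h1.lt_or_eq with h | rfl
  · exact quadFormula_zpow_mul_of_lt k h0 h
  -- At `u = 1` the floor jumps: the point is the left end of the next dyadic interval, and both
  -- formulas give the fixed point `2 ^ (k + 1)`.
  · have := quadFormula_zpow_mul_of_lt (k + 1) le_rfl zero_lt_one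
    rw [zpow_two_add_one] at this
    norm_num at this ⊢
    exact this

theorem quadFormula_zpow (k : ℤ) : quadFormula (2 ^ k) = 2 ^ k := by
  simpa using quadFormula_zpow_mul k le_rfl zero_le_one

theorem quadFormula_one : quadFormula 1 = 1 := by simpa using quadFormula_zpow 0

theorem exists_eq_zpow_mul {x : ℝ} (hx : 0 < x) :
    ∃ (k : ℤ) (u : ℝ), 0 ≤ u ∧ u < 1 ∧ x = 2 ^ k * (1 + u) := by
  obtain ⟨k, h1, h2⟩ := exists_dyadic hx
  have hp : (0 : ℝ) < 2 ^ k := by positivity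
  rw [zpow_two_add_one] at h2
  refine ⟨k, x / 2 ^ k - 1, ?_, ?_, ?_⟩
  · rw [sub_nonneg, le_div_iff₀ hp]; linarith
  · rw [sub_lt_iff_lt_add, div_lt_iff₀ hp]; linarith
  · field_simp; ring

/-- Each dyadic interval is mapped into itself, so the fixed point `2 ^ k` is a barrier for orbits.
This is what keeps `J_1` of a positive point positive. -/
theorem zpow_le_quadFormula {k : ℤ} {x : ℝ} (hx : (2 : ℝ) ^ k ≤ x) :
    (2 : ℝ) ^ k ≤ quadFormula x := by
  have hp : (0 : ℝ) < 2 ^ k := by positivity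
  obtain ⟨l, u, h0, h1, rfl⟩ := exists_eq_zpow_mul (hp.trans_le hx)
  have hl : (0 : ℝ) < 2 ^ l := by positivity
  have hkl : k ≤ l := by
    have : (2 : ℝ) ^ k < 2 ^ (l + 1) := by rw [zpow_two_add_one]; nlinarith
    rw [zpow_lt_zpow_iff_right₀ one_lt_two] at this
    omega
  rw [quadFormula_zpow_mul l h0 h1.le]
  refine (zpow_le_zpow_right₀ one_le_two hkl).trans ?_
  nlinarith [mul_nonneg hl.le (sq_nonneg u)]

theorem quadFormula_pos {x : ℝ} (hx : 0 < x) : 0 < quadFormula x := by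
  obtain ⟨k, hk, -⟩ := exists_dyadic hx
  exact lt_of_lt_of_le (by positivity) (zpow_le_quadFormula hk)

theorem quadFormula_nonneg {x : ℝ} (hx : 0 ≤ x) : 0 ≤ quadFormula x := by
  rcases hx.eq_or_lt with rfl | h
  · exact quadFormula_zero.ge
  · exact (quadFormula_pos h).le

theorem quadFormula_le_self {x : ℝ} (hx : 0 < x) : quadFormula x ≤ x := by
  obtain ⟨k, u, h0, h1, rfl⟩ := exists_eq_zpow_mul hx
  rw [quadFormula_zpow_mul k h0 h1.le]
  have hp : (0 : ℝ) < 2 ^ k := by positivity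
  gcongr
  nlinarith

theorem neg_of_quadFormula_neg {x : ℝ} (h : quadFormula x < 0) : x < 0 :=
  not_le.1 fun hx => (quadFormula_nonneg hx).not_gt h

theorem quadFormula_lt_self {x : ℝ} (h1 : -1 < x) (h0 : x < 0) : quadFormula x < x := by
  rw [quadFormula_of_nonpos h0.le]; nlinarith

theorem neg_one_lt_quadFormula {x : ℝ} (h1 : -1 < x) : -1 < quadFormula x := by
  rcases le_or_gt x 0 with h | h
  · rw [quadFormula_of_nonpos h]; nlinarith
  · linarith [quadFormula_pos h]

theorem quadFormula_le_of_nonpos {x y : ℝ} (hx : -1 ≤ x) (hxy : x ≤ y) (hy : y ≤ 0) :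
    quadFormula x ≤ quadFormula y := by
  rw [quadFormula_of_nonpos (hxy.trans hy), quadFormula_of_nonpos hy]; nlinarith

theorem continuousOn_quadFormula_dyadic (k : ℤ) :
    ContinuousOn quadFormula (Set.Icc ((2 : ℝ) ^ k) (2 ^ (k + 1))) := by
  have hp : (0 : ℝ) < 2 ^ k := by positivity
  have : ContinuousOn (fun x : ℝ => (2 : ℝ) ^ k * (1 + (x / 2 ^ k - 1) ^ 2))
      (Set.Icc ((2 : ℝ) ^ k) (2 ^ (k + 1))) := by fun_prop
  refine this.congr fun x hx => ?_
  obtain ⟨h1, h2⟩ := hx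
  rw [zpow_two_add_one] at h2
  beta_reduce
  rw [← quadFormula_zpow_mul k (sub_nonneg.2 ((one_le_div hp).2 h1))
    (by rw [sub_le_iff_le_add, div_le_iff₀ hp]; linarith)]
  congr 1
  field_simp
  ring

theorem continuous_quadFormula : Continuous quadFormula := by
  rw [continuous_iff_continuousAt]
  intro x
  rcases lt_trichotomy x 0 with hx | rfl | hx
  · have : ContinuousAt (fun x : ℝ => (x + 1) ^ 2 - 1) x := by fun_prop
    refine this.congr ?_
    filter_upwards [Iio_mem_nhds hx] with y hy
    exact (quadFormula_of_nonpos (le_of_lt hy)).symm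
  · have hg : Filter.Tendsto (fun x : ℝ => |(x + 1) ^ 2 - 1| + |x|) (nhds 0) (nhds 0) := by
      have : Continuous (fun x : ℝ => |(x + 1) ^ 2 - 1| + |x|) := by fun_prop
      simpa using this.tendsto 0
    rw [ContinuousAt, quadFormula_zero]
    refine squeeze_zero_norm (fun y => ?_) hg
    rw [Real.norm_eq_abs]
    rcases le_or_gt y 0 with h | h
    · rw [quadFormula_of_nonpos h]
      exact le_add_of_nonneg_right (abs_nonneg _)
    · rw [abs_of_pos (quadFormula_pos h), abs_of_pos h]
      linarith [quadFormula_le_self h, abs_nonneg ((y + 1) ^ 2 - 1)]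
  · obtain ⟨k, h1, h2⟩ := exists_dyadic hx
    -- Two adjacent intervals are glued because `x` may be the common end point `2 ^ k`.
    have hc := (continuousOn_quadFormula_dyadic (k - 1)).union_of_isClosed
      (continuousOn_quadFormula_dyadic k) isClosed_Icc isClosed_Icc
    rw [sub_add_cancel, Set.Icc_union_Icc_eq_Icc
      (zpow_le_zpow_right₀ one_le_two (by omega)) (zpow_le_zpow_right₀ one_le_two (by omega))] at hc
    refine hc.continuousAt (Icc_mem_nhds (lt_of_lt_of_le ?_ h1) h2)
    exact zpow_lt_zpow_right₀ one_lt_two (by omega)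

theorem continuous_quadMap : Continuous quadMap :=
  (continuous_quadFormula.comp continuous_subtype_val).subtype_mk _

end Dynamics

/-! ### Two-sided orbits -/

section Orbits

/-- The two-sided orbit `j ↦ t ^ (2 ^ j)` of `t` under squaring. -/
noncomputable def squaringOrbit (t : ℝ) (j : ℤ) : ℝ := t ^ ((2 : ℝ) ^ j)

variable {t : ℝ}

theorem squaringOrbit_zero : squaringOrbit t 0 = t := by simp [squaringOrbit]

theorem squaringOrbit_pos (h0 : 0 < t) (j : ℤ) : 0 < squaringOrbit t j := Real.rpow_pos_of_pos h0 _

theorem squaringOrbit_lt_one (h0 : 0 < t) (h1 : t < 1) (j : ℤ) : squaringOrbit t j < 1 :=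
  Real.rpow_lt_one h0.le h1 (by positivity)

theorem squaringOrbit_sq (h0 : 0 < t) (j : ℤ) :
    squaringOrbit t j ^ 2 = squaringOrbit t (j + 1) := by
  rw [squaringOrbit, squaringOrbit, ← Real.rpow_natCast, ← Real.rpow_mul h0.le, zpow_two_add_one]
  norm_num

theorem squaringOrbit_strictAnti (h0 : 0 < t) (h1 : t < 1) : StrictAnti (squaringOrbit t) :=
  fun _ _ h => Real.rpow_lt_rpow_of_exponent_gt h0 h1 (zpow_lt_zpow_right₀ one_lt_two h)

theorem tendsto_squaringOrbit_natCast (h0 : 0 < t) (h1 : t < 1) :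
    Filter.Tendsto (fun n : ℕ => squaringOrbit t n) Filter.atTop (nhds 0) := by
  have h : Filter.Tendsto (fun n : ℕ => (2 : ℝ) ^ (n : ℤ)) Filter.atTop Filter.atTop := by
    simpa using tendsto_pow_atTop_atTop_of_one_lt (one_lt_two : (1 : ℝ) < 2)
  exact (tendsto_rpow_atTop_of_base_lt_one t (by linarith) h1).comp h

theorem tendsto_squaringOrbit_neg_natCast (h0 : 0 < t) :
    Filter.Tendsto (fun n : ℕ => squaringOrbit t (-n)) Filter.atTop (nhds 1) := by
  have h : Filter.Tendsto (fun n : ℕ => (2 : ℝ) ^ (-(n : ℤ))) Filter.atTop (nhds 0) := by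
    have := tendsto_pow_atTop_nhds_zero_of_lt_one (r := (2⁻¹ : ℝ)) (by norm_num) (by norm_num)
    simpa using this
  have := (Real.continuous_const_rpow h0.ne').tendsto 0 |>.comp h
  rw [Real.rpow_zero] at this
  exact this

/-- The two-sided orbit in `(2 ^ (-k-1), 2 ^ (-k))`. -/
noncomputable def dyadicOrbit (k : ℕ) (j : ℤ) : ℝ :=
  2 ^ (-(k : ℤ) - 1) * (1 + squaringOrbit 2⁻¹ j)

theorem half_pos_lt_one : (0 : ℝ) < 2⁻¹ ∧ (2⁻¹ : ℝ) < 1 := by norm_num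

theorem quadFormula_dyadicOrbit (k : ℕ) (j : ℤ) :
    quadFormula (dyadicOrbit k j) = dyadicOrbit k (j + 1) := by
  rw [dyadicOrbit, quadFormula_zpow_mul _ (squaringOrbit_pos half_pos_lt_one.1 j).le
    (squaringOrbit_lt_one half_pos_lt_one.1 half_pos_lt_one.2 j).le,
    squaringOrbit_sq half_pos_lt_one.1, dyadicOrbit]

theorem quadFormula_squaringOrbit_sub_one (h0 : 0 < t) (h1 : t < 1) (j : ℤ) :
    quadFormula (squaringOrbit t j - 1) = squaringOrbit t (j + 1) - 1 := by
  rw [quadFormula_of_nonpos (by linarith [squaringOrbit_lt_one h0 h1 j]), sub_add_cancel,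
    squaringOrbit_sq h0]

theorem dyadicOrbit_bounds (k : ℕ) (j : ℤ) :
    (2 : ℝ) ^ (-(k : ℤ) - 1) < dyadicOrbit k j ∧ dyadicOrbit k j < 2 ^ (-(k : ℤ)) := by
  have h1 := squaringOrbit_pos half_pos_lt_one.1 j
  have h2 := squaringOrbit_lt_one half_pos_lt_one.1 half_pos_lt_one.2 j
  have hp : (0 : ℝ) < 2 ^ (-(k : ℤ) - 1) := by positivity
  have : (2 : ℝ) ^ (-(k : ℤ)) = 2 ^ (-(k : ℤ) - 1) * 2 := by
    rw [← zpow_two_add_one, sub_add_cancel]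
  rw [this, dyadicOrbit]
  constructor <;> nlinarith

end Orbits

/-! ### The two order types are realized -/

section Realizations

/-- Later blocks lie closer to `0`, and within a block squaring decreases. Hence the lexicographic
order, of type `ζ · ω`, is the reverse of the order of the reals. -/
theorem dyadicOrbit_lt {k l : ℕ} {a b : ℤ} (h : toLex (k, a) < toLex (l, b)) :
    dyadicOrbit l b < dyadicOrbit k a := by
  rcases Prod.Lex.toLex_lt_toLex.1 h with h | ⟨rfl, h⟩
  · refine (dyadicOrbit_bounds l b).2.trans (lt_of_le_of_lt ?_ (dyadicOrbit_bounds k a).1)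
    dsimp only at h
    exact zpow_le_zpow_right₀ one_le_two (by omega)
  · have := squaringOrbit_strictAnti half_pos_lt_one.1 half_pos_lt_one.2 h
    dsimp only at this ⊢
    unfold dyadicOrbit
    gcongr

/-- Following the full orbits in all dyadic intervals and then a family `ψ` of points of
`(-1, 0)` realizes the order type `ζ · ω` followed by that of the index set of `ψ`. -/
theorem type_sum_mem_spectrum {J : Type} [LinearOrder J] {ψ : J → ℝ} (hψ : StrictAnti ψ)
    (hψ_mem : ∀ j, ψ j ∈ Set.Ioo (-1 : ℝ) 0) {x y : Set.Icc (-1 : ℝ) 1} (hx : (x : ℝ) = 1)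
    (hy : (y : ℝ) < 0) (hψy : ∀ j, ψ j ≠ y) {G : ℕ → Finset J} (hG : Monotone G)
    (hne : ∀ n, (G n).Nonempty) (hex : ∀ j, ∃ n, j ∈ G n) {δ : ℕ → ℝ} (hδ : Antitone δ)
    (hδ0 : ∀ n, 0 ≤ δ n) (hlim : Filter.Tendsto δ Filter.atTop (nhds 0))
    (hfirst : ∀ n, ∀ i ∈ G n, (∀ j ∈ G n, i ≤ j) → -δ n ≤ ψ i)
    (hstep : ∀ n, ∀ i ∈ G n, ∀ j ∈ G n, i < j → (∀ l ∈ G n, l ≤ i ∨ j ≤ l) →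
      quadFormula (ψ i) = ψ j)
    (hlast : ∀ n, ∀ i ∈ G n, (∀ j ∈ G n, j ≤ i) → |quadFormula (ψ i) - y| ≤ δ n) :
    OrderType.type ((ℕ ×ₗ ℤ) ⊕ₗ J) ∈ spectrum quadMap x y := by
  set s : ℤ → ℝ := squaringOrbit 2⁻¹ with hs
  have hs0 : ∀ j, 0 < s j := squaringOrbit_pos half_pos_lt_one.1
  have hs1 : ∀ j, s j < 1 := squaringOrbit_lt_one half_pos_lt_one.1 half_pos_lt_one.2
  have hsa : StrictAnti s := squaringOrbit_strictAnti half_pos_lt_one.1 half_pos_lt_one.2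
  have hd : ∀ k j, -1 < dyadicOrbit k j ∧ 0 < dyadicOrbit k j ∧ dyadicOrbit k j < 1 := by
    intro k j
    obtain ⟨h1, h2⟩ := dyadicOrbit_bounds k j
    have h3 : 0 < dyadicOrbit k j := lt_trans (by positivity) h1
    exact ⟨by linarith, h3, h2.trans_le (zpow_le_one_of_nonpos₀ one_le_two (by omega))⟩
  let φ : (ℕ ×ₗ ℤ) ⊕ₗ J → Set.Icc (-1 : ℝ) 1 := fun i =>
    Sum.elim
      (fun p => ⟨dyadicOrbit (ofLex p).1 (ofLex p).2, (hd _ _).1.le, (hd _ _).2.2.le⟩)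
      (fun j => ⟨ψ j, (hψ_mem j).1.le, (hψ_mem j).2.le.trans zero_le_one⟩) (ofLex i)
  have hφ : StrictAnti φ := by
    intro i j hij
    induction i using Lex.rec with | h i =>
    induction j using Lex.rec with | h j =>
    rcases i with p | i <;> rcases j with q | j
    · exact Subtype.mk_lt_mk.2 (dyadicOrbit_lt (Sum.Lex.inl_lt_inl_iff.1 hij))
    · exact Subtype.mk_lt_mk.2 ((hψ_mem j).2.trans (hd _ _).2.1)
    · exact absurd hij Sum.Lex.not_inr_lt_inl
    · exact Subtype.mk_lt_mk.2 (hψ (Sum.Lex.inr_lt_inr_iff.1 hij))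
  -- Stage `n` keeps blocks `0, …, n`, times `-n, …, n` in each, and then `G n`.
  let F : ℕ → Finset ((ℕ ×ₗ ℤ) ⊕ₗ J) := fun n =>
    (((Finset.range (n + 1) ×ˢ Finset.Icc (-n : ℤ) n).map toLex.toEmbedding).disjSum (G n)).map
      toLex.toEmbedding
  have hFl : ∀ n k a, toLex (Sum.inl (toLex (k, a))) ∈ F n ↔ k ≤ n ∧ -n ≤ a ∧ a ≤ n := by
    intro n k a
    simp [F]
  have hFr : ∀ n j, toLex (Sum.inr j) ∈ F n ↔ j ∈ G n := by
    intro n j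
    simp [F]
  -- The only inexact steps are jumps: `1 - s (-n)` pays for entering a block at time `-n`, `s n`
  -- for leaving one after time `n`, `2⁻¹ ^ n` for crossing `0` from the last block, and `δ n` for
  -- the errors on the negative side.
  set ε : ℕ → ℝ := fun n => 2 * 2⁻¹ ^ n + (1 - s (-n)) + s n + δ n with hε
  have hεpos : ∀ n, 0 < ε n := fun n => by
    have h1 := hs1 (-n)
    have h2 := hs0 n
    have h3 := hδ0 n
    have h4 : (0 : ℝ) < 2⁻¹ ^ n := by positivity
    simp only [hε]
    linarith
  refine type_mem_spectrum (φ := φ) (F := F) (ε := ε) hφ.injective ?_ ?_ ?_ ?_ ?_ hεpos ?_ ?_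
    ?_ ?_ ?_
  · rintro (p | j) h <;> rw [← h] at hx
    · exact (hd _ _).2.2.ne hx
    · exact ((hψ_mem j).2.trans zero_lt_one).ne hx
  · rintro (p | j) h
    · rw [← h] at hy
      exact (hd _ _).2.1.not_gt hy
    · exact hψy j (congrArg Subtype.val h)
  · intro m n hmn i hi
    induction i using Lex.rec with | h i =>
    rcases i with ⟨k, a⟩ | j
    · have := (hFl m k a).1 hi
      exact (hFl n k a).2 (by omega)
    · exact (hFr n j).2 (hG hmn ((hFr m j).1 hi))
  · exact fun n => ⟨_, (hFl n 0 0).2 (by omega)⟩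
  · rintro (⟨k, a⟩ | j)
    · exact ⟨k + a.natAbs, (hFl _ k a).2 (by omega)⟩
    · obtain ⟨n, hn⟩ := hex j
      exact ⟨n, (hFr n j).2 hn⟩
  · intro m n hmn
    have h1 : s (-m) ≤ s (-n) → (1 - s (-n)) ≤ 1 - s (-m) := fun h => by linarith
    have h2 := h1 (hsa.antitone (by omega))
    have h3 : s n ≤ s m := hsa.antitone (by omega)
    have h4 : (2⁻¹ : ℝ) ^ n ≤ 2⁻¹ ^ m := pow_le_pow_of_le_one (by norm_num) (by norm_num) hmn
    have h5 := hδ hmn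
    simp only [hε]
    linarith
  · have h1 := (tendsto_pow_atTop_nhds_zero_of_lt_one (r := (2⁻¹ : ℝ)) (by norm_num)
      (by norm_num)).const_mul 2
    have h2 := (tendsto_squaringOrbit_neg_natCast half_pos_lt_one.1).const_sub 1
    have h3 := tendsto_squaringOrbit_natCast half_pos_lt_one.1 half_pos_lt_one.2
    simpa [hε, ← hs] using ((h1.add h2).add h3).add hlim
  · intro n i hi hmin
    have h0 := hmin _ ((hFl n 0 (-n)).2 (by omega))
    have hle := hφ.antitone h0
    have h1 : dyadicOrbit 0 (-n) ≤ φ i := hle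
    have h2 : (φ i : ℝ) ≤ 1 := (φ i).2.2
    rw [Subtype.dist_eq, Real.dist_eq]
    change |quadFormula x - φ i| < ε n
    rw [hx, quadFormula_one, abs_of_nonneg (by linarith)]
    have h3 : dyadicOrbit 0 (-n) = 2⁻¹ * (1 + s (-n)) := by simp [dyadicOrbit, hs]
    have h4 := hs1 (-n)
    have h5 := hs0 n
    have h6 := hδ0 n
    have h7 : (0 : ℝ) < 2⁻¹ ^ n := by positivity
    simp only [hε]
    linarith
  · intro n i hi j hj hij hl
    rw [Subtype.dist_eq, Real.dist_eq]
    change |quadFormula (φ i) - φ j| < ε n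
    induction i using Lex.rec with | h i =>
    induction j using Lex.rec with | h j =>
    rcases i with ⟨k, a⟩ | i <;> rcases j with ⟨l, b⟩ | j
    · change |quadFormula (dyadicOrbit k a) - dyadicOrbit l b| < ε n
      rw [quadFormula_dyadicOrbit]
      have hi' := (hFl n k a).1 hi
      have hj' := (hFl n l b).1 hj
      have hij' := Prod.Lex.toLex_lt_toLex.1 (Sum.Lex.inl_lt_inl_iff.1 hij)
      -- Nothing in the truncation lies strictly between the two indices. Testing this on the
      -- expected successor identifies `(l, b)`: the next time in the block, or time `-n` of the
      -- next block.
      have key : ∀ (k' : ℕ) (a' : ℤ), k' ≤ n → -n ≤ a' ∧ a' ≤ n →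
          (k' < k ∨ k' = k ∧ a' ≤ a) ∨ (l < k' ∨ l = k' ∧ b ≤ a') := by
        intro k' a' h1 h2
        refine (hl _ ((hFl n k' a').2 ⟨h1, h2⟩)).imp (fun h => ?_) (fun h => ?_)
        · exact Prod.Lex.toLex_le_toLex.1 (Sum.Lex.inl_le_inl_iff.1 h)
        · exact Prod.Lex.toLex_le_toLex.1 (Sum.Lex.inl_le_inl_iff.1 h)
      dsimp only at hij'
      rcases hi'.2.2.lt_or_eq with ha | ha
      · have := key k (a + 1) hi'.1 (by omega)
        obtain ⟨rfl, rfl⟩ : l = k ∧ b = a + 1 := by omega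
        rw [sub_self, abs_zero]
        exact hεpos n
      · have := key (k + 1) (-n) (by omega) (by omega)
        obtain ⟨rfl, rfl⟩ : l = k + 1 ∧ b = -n := by omega
        subst ha
        have hp : (0 : ℝ) < 2 ^ (-((k + 1 : ℕ) : ℤ) - 1) := by positivity
        have hp1 : (2 : ℝ) ^ (-((k + 1 : ℕ) : ℤ) - 1) * 2 ≤ 1 := by
          rw [← zpow_two_add_one]
          exact zpow_le_one_of_nonpos₀ one_le_two (by omega)
        have h1 : dyadicOrbit k (n + 1) =
            2 ^ (-((k + 1 : ℕ) : ℤ) - 1) * 2 * (1 + s (n + 1)) := by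
          rw [← zpow_two_add_one, dyadicOrbit, hs]
          congr 2
          push_cast
          ring
        have h2 : dyadicOrbit (k + 1) (-n) = 2 ^ (-((k + 1 : ℕ) : ℤ) - 1) * (1 + s (-n)) := rfl
        rw [h1, h2]
        generalize (2 : ℝ) ^ (-((k + 1 : ℕ) : ℤ) - 1) = p at *
        have h3 := hs1 (-n)
        have h4 := hs0 (n + 1)
        have h5 : s (n + 1) < s n := hsa (by omega)
        have h6 := hδ0 n
        have h7 : (0 : ℝ) < 2⁻¹ ^ n := by positivity
        rw [abs_of_nonneg (by nlinarith)]
        simp only [hε]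
        nlinarith
    · change |quadFormula (dyadicOrbit k a) - ψ j| < ε n
      rw [quadFormula_dyadicOrbit]
      have hi' := (hFl n k a).1 hi
      have hkn := (hl _ ((hFl n n n).2 (by omega))).resolve_right Sum.Lex.not_inr_le_inl
      have hkn' := Prod.Lex.toLex_le_toLex.1 (Sum.Lex.inl_le_inl_iff.1 hkn)
      dsimp only at hkn'
      obtain ⟨rfl, rfl⟩ : k = n ∧ a = n := by omega
      have h1 := hfirst k j ((hFr k j).1 hj) fun j' hj' =>
        Sum.Lex.inr_le_inr_iff.1 ((hl _ ((hFr k j').2 hj')).resolve_left Sum.Lex.not_inr_le_inl)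
      have h2 := (dyadicOrbit_bounds k (k + 1)).2
      rw [zpow_neg, zpow_natCast, ← inv_pow] at h2
      have h3 := (hd k (k + 1)).2.1
      have h4 := (hψ_mem j).2
      have h5 := hs1 (-k)
      have h6 := hs0 k
      rw [abs_of_nonneg (by linarith)]
      simp only [hε]
      linarith
    · exact absurd hij Sum.Lex.not_inr_lt_inl
    · change |quadFormula (ψ i) - ψ j| < ε n
      rw [hstep n i ((hFr n i).1 hi) j ((hFr n j).1 hj) (Sum.Lex.inr_lt_inr_iff.1 hij) fun l h =>
        (hl _ ((hFr n l).2 h)).imp Sum.Lex.inr_le_inr_iff.1 Sum.Lex.inr_le_inr_iff.1,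
        sub_self, abs_zero]
      exact hεpos n
  · intro n i hi hmax
    induction i using Lex.rec with | h i =>
    rcases i with p | i
    · obtain ⟨j, hj⟩ := hne n
      exact absurd (hmax _ ((hFr n j).2 hj)) Sum.Lex.not_inr_le_inl
    · rw [Subtype.dist_eq, Real.dist_eq]
      refine lt_of_le_of_lt (hlast n i ((hFr n i).1 hi) fun j hj =>
        Sum.Lex.inr_le_inr_iff.1 (hmax _ ((hFr n j).2 hj))) ?_
      have h1 := hs1 (-n)
      have h2 := hs0 n
      have h4 : (0 : ℝ) < 2⁻¹ ^ n := by positivity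
      simp only [hε]
      linarith

theorem zeta_mul_omega_add_zeta_mem {x y : Set.Icc (-1 : ℝ) 1} (hx : (x : ℝ) = 1)
    (hy : (y : ℝ) = -1) : zeta * omegaType + zeta ∈ spectrum quadMap x y := by
  rw [zeta, omegaType, ← OrderType.type_lex_prod, ← OrderType.type_lex_sum]
  set s : ℤ → ℝ := squaringOrbit 2⁻¹ with hs
  have hs0 : ∀ j, 0 < s j := squaringOrbit_pos half_pos_lt_one.1
  have hs1 : ∀ j, s j < 1 := squaringOrbit_lt_one half_pos_lt_one.1 half_pos_lt_one.2
  have hsa : StrictAnti s := squaringOrbit_strictAnti half_pos_lt_one.1 half_pos_lt_one.2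
  -- A full orbit from `0` to `-1`; the two terms of `δ` are the gaps at its two ends.
  refine type_sum_mem_spectrum (ψ := fun j => s j - 1) (G := fun n => Finset.Icc (-n : ℤ) n)
    (δ := fun n => (1 - s (-n)) + s n) ?_ ?_ hx (by linarith) ?_ ?_ ?_ ?_ ?_ ?_ ?_ ?_ ?_ ?_
  · exact fun i j h => sub_lt_sub_right (hsa h) 1
  · exact fun j => ⟨by linarith [hs0 j], by linarith [hs1 j]⟩
  · intro j h
    linarith [hs0 j]
  · exact fun m n h => Finset.Icc_subset_Icc (by omega) (by omega)
  · exact fun n => ⟨0, by simp⟩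
  · exact fun j => ⟨j.natAbs, Finset.mem_Icc.2 (by omega)⟩
  · intro m n h
    have h1 : s (-m) ≤ s (-n) := hsa.antitone (by omega)
    have h2 : s n ≤ s m := hsa.antitone (by omega)
    dsimp only
    linarith
  · intro n
    linarith [hs1 (-n), hs0 n]
  · have h2 := (tendsto_squaringOrbit_neg_natCast half_pos_lt_one.1).const_sub 1
    have h3 := tendsto_squaringOrbit_natCast half_pos_lt_one.1 half_pos_lt_one.2
    simpa using h2.add h3
  · intro n i hi hmin
    have h1 := Finset.mem_Icc.1 hi
    have h2 := hmin (-n) (Finset.mem_Icc.2 (by omega))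
    obtain rfl : i = -n := by omega
    linarith [hs0 n]
  · intro n i hi j hj hij hl
    rw [Finset.mem_Icc] at hi hj
    have := hl (i + 1) (Finset.mem_Icc.2 (by omega))
    obtain rfl : j = i + 1 := by omega
    exact quadFormula_squaringOrbit_sub_one half_pos_lt_one.1 half_pos_lt_one.2 i
  · intro n i hi hmax
    have h1 := Finset.mem_Icc.1 hi
    have h2 := hmax n (Finset.mem_Icc.2 (by omega))
    obtain rfl : i = n := by omega
    rw [quadFormula_squaringOrbit_sub_one half_pos_lt_one.1 half_pos_lt_one.2, hy,
      sub_neg_eq_add, sub_add_cancel, abs_of_pos (hs0 _)]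
    have h3 : s (n + 1) < s n := hsa (by omega)
    have h4 := hs1 (-n)
    linarith

theorem zeta_mul_omega_add_omegaStar_mem {x y : Set.Icc (-1 : ℝ) 1} (hx : (x : ℝ) = 1)
    (hy : (y : ℝ) ∈ Set.Ioo (-1 : ℝ) 0) :
    zeta * omegaType + omegaStar ∈ spectrum quadMap x y := by
  rw [zeta, omegaType, omegaStar, ← OrderType.type_lex_prod, ← OrderType.type_lex_sum]
  have ht0 : (0 : ℝ) < y + 1 := by linarith [hy.1]
  have ht1 : (y + 1 : ℝ) < 1 := by linarith [hy.2]
  set s : ℤ → ℝ := squaringOrbit (y + 1) with hs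
  have hs0 : ∀ j, 0 < s j := squaringOrbit_pos ht0
  have hs1 : ∀ j, s j < 1 := squaringOrbit_lt_one ht0 ht1
  have hsa : StrictAnti s := squaringOrbit_strictAnti ht0 ht1
  have hstep : ∀ j, quadFormula (s j - 1) = s (j + 1) - 1 :=
    quadFormula_squaringOrbit_sub_one ht0 ht1
  have hsz : s 0 = y + 1 := squaringOrbit_zero
  -- The backward orbit of `y = s 0 - 1`, with the deepest preimage first. The shift by `-1` leaves
  -- out `y` itself, and the last step hits `y` exactly, so `δ` only covers the gap at `0`.
  refine type_sum_mem_spectrum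
    (ψ := fun j : ℕᵒᵈ => s (-((OrderDual.ofDual j : ℕ) : ℤ) - 1) - 1)
    (G := fun n => (Finset.range (n + 1)).map OrderDual.toDual.toEmbedding)
    (δ := fun n => 1 - s (-n)) ?_ ?_ hx hy.2 ?_ ?_ ?_ ?_ ?_ ?_ ?_ ?_ ?_ ?_
  · intro i j h
    have : OrderDual.ofDual j < OrderDual.ofDual i := h
    exact sub_lt_sub_right (hsa (by omega)) 1
  · exact fun j => ⟨by linarith [hs0 (-((OrderDual.ofDual j : ℕ) : ℤ) - 1)],
      by linarith [hs1 (-((OrderDual.ofDual j : ℕ) : ℤ) - 1)]⟩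
  · intro j h
    have : s 0 < s (-((OrderDual.ofDual j : ℕ) : ℤ) - 1) := hsa (by omega)
    linarith
  · exact fun m n h => Finset.map_subset_map.2 (Finset.range_mono (by omega))
  · exact fun n => ⟨OrderDual.toDual 0, by simp⟩
  · exact fun j => ⟨OrderDual.ofDual j, by simp⟩
  · intro m n h
    have h1 : s (-m) ≤ s (-n) := hsa.antitone (by omega)
    dsimp only
    linarith
  · intro n
    linarith [hs1 (-n)]
  · simpa using (tendsto_squaringOrbit_neg_natCast ht0).const_sub 1
  · intro n i hi hmin
    have h2 : n ≤ OrderDual.ofDual i := hmin (OrderDual.toDual n) (by simp)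
    have h3 : s (-n) ≤ s (-((OrderDual.ofDual i : ℕ) : ℤ) - 1) := hsa.antitone (by omega)
    linarith
  · intro n i hi j hj hij hl
    have hij' : OrderDual.ofDual j < OrderDual.ofDual i := hij
    have hi' : OrderDual.ofDual i < n + 1 := by simpa using hi
    have := hl (OrderDual.toDual (OrderDual.ofDual j + 1)) (by simp; omega)
    have h2 : OrderDual.ofDual i ≤ OrderDual.ofDual j + 1 := this.resolve_right fun h =>
      (Nat.lt_succ_self _).not_ge
        (show OrderDual.ofDual j + 1 ≤ OrderDual.ofDual j from h)
    rw [hstep]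
    congr 2
    omega
  · intro n i hi hmax
    have h2 : OrderDual.ofDual i ≤ 0 := hmax (OrderDual.toDual 0) (by simp)
    have h3 : OrderDual.ofDual i = 0 := by omega
    rw [hstep, h3]
    norm_num [hsz]
    exact (hs1 _).le

end Realizations

/-! ### Maximum of the limit order -/

section Obstructions

/-- The map is monotone on `[-1, 0]`, so from `[-1, c]` it lands at or below `quadFormula c ≤ c -
ε`, and an error below `ε` cannot climb back over `c`. Chains that get below `c` are trapped there.
-/
theorem EpsChain.le_of_le {ε : ℝ} {x y : Set.Icc (-1 : ℝ) 1} (C : EpsChain quadMap ε x y) {c : ℝ}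
    (hc : c ≤ 0) (hε : ε ≤ c - quadFormula c) {i j : ℕ} (hij : i ≤ j) (hj : j ≤ C.len)
    (hi : (C.pt i : ℝ) ≤ c) : (C.pt j : ℝ) ≤ c := by
  induction j, hij using Nat.le_induction with
  | base => exact hi
  | succ j hij ih =>
    have h1 := quadFormula_le_of_nonpos (C.pt j).2.1 (ih (by omega)) hc
    have h2 := C.step j (by omega)
    rw [Subtype.dist_eq, Real.dist_eq] at h2
    have h3 := (abs_lt.1 h2).1
    change -ε < quadFormula (C.pt j) - C.pt (j + 1) at h3
    linarith

theorem EpsChain.one_lt_len {ε : ℝ} {x y : Set.Icc (-1 : ℝ) 1} (C : EpsChain quadMap ε x y)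
    (hε : ε ≤ 1) (hx : (x : ℝ) = 1) (hy : (y : ℝ) < 0) : 1 < C.len := by
  refine lt_of_le_of_ne C.one_le_len fun h => ?_
  have h2 := C.step 0 C.one_le_len
  rw [zero_add, h, C.pt_len, C.pt_zero, Subtype.dist_eq, Real.dist_eq] at h2
  have h3 := (abs_lt.1 h2).2
  change quadFormula x - y < ε at h3
  rw [hx, quadFormula_one] at h3
  linarith

theorem EpsChain.abs_quadFormula_penultimate_lt {ε : ℝ} {x y : Set.Icc (-1 : ℝ) 1}
    (C : EpsChain quadMap ε x y) : |quadFormula (C.pt (C.len - 1)) - y| < ε := by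
  have h := C.step (C.len - 1) (Nat.sub_lt C.one_le_len one_pos)
  rw [Nat.sub_add_cancel C.one_le_len, C.pt_len, Subtype.dist_eq, Real.dist_eq] at h
  exact h

theorem EpsChain.Acyclic.penultimate_ne {X : Type*} [MetricSpace X] {f : X → X} {ε : ℝ} {x y : X}
    {C : EpsChain f ε x y} (hC : C.Acyclic) (hlen : 1 < C.len) :
    C.pt (C.len - 1) ∉ ({x, y} : Set X) := by
  have h := hC.2 (C.len - 1) (by omega) (by omega)
  rw [C.pt_zero, C.pt_len] at h
  rintro (h' | h')
  · exact h.1 h'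
  · exact h.2 h'

theorem EpsChain.exists_interior_index {X : Type*} [MetricSpace X] {f : X → X} {ε : ℝ} {x y z : X}
    {C : EpsChain f ε x y} (hz : z ∈ C.support) (hz' : z ∉ ({x, y} : Set X)) :
    ∃ i, 0 < i ∧ i < C.len ∧ C.pt i = z := by
  obtain ⟨i, hi, rfl⟩ := hz
  refine ⟨i, Nat.pos_of_ne_zero ?_, lt_of_le_of_ne hi ?_, rfl⟩
  · rintro rfl
    exact hz' (.inl C.pt_zero)
  · intro h
    exact hz' (.inr (by rw [h]; exact C.pt_len))

theorem OrdinatelyNested.exists_lt {X : Type*} [MetricSpace X] {f : X → X} {ε : ℕ → ℝ} {x y : X}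
    {C : ∀ n, EpsChain f (ε n) x y} (hC : OrdinatelyNested C) {η : ℝ} (hη : 0 < η) :
    ∃ N, ∀ n ≥ N, ε n < η :=
  Filter.eventually_atTop.1 (hC.tendsto.eventually (gt_mem_nhds hη))

theorem OrdinatelyNested.monotone_support {X : Type*} [MetricSpace X] {f : X → X} {ε : ℕ → ℝ}
    {x y : X} {C : ∀ n, EpsChain f (ε n) x y} (hC : OrdinatelyNested C) :
    Monotone fun n => (C n).support :=
  monotone_nat_of_le_succ hC.nested

theorem EpsChain.pt_mem_support {X : Type*} [MetricSpace X] {f : X → X} {ε : ℝ} {x y : X}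
    (C : EpsChain f ε x y) {i : ℕ} (hi : i ≤ C.len) : C.pt i ∈ C.support := ⟨i, hi, rfl⟩

/-- In the coordinate `d = c + 1` the map is squaring, so any `d` strictly between `y + 1` and its
square root works. -/
theorem exists_quadFormula_lt {y : ℝ} (h1 : -1 < y) (h0 : y < 0) :
    ∃ c, y < c ∧ c < 0 ∧ quadFormula c < y := by
  have ht : 0 < y + 1 := by linarith
  obtain ⟨d, hd1, hd2⟩ := exists_between ((Real.lt_sqrt ht.le).2 (by nlinarith :
    (y + 1) ^ 2 < y + 1))
  have hd3 := (Real.lt_sqrt (ht.trans hd1).le).1 hd2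
  have hd4 : d < 1 := by nlinarith
  refine ⟨d - 1, by linarith, by linarith, ?_⟩
  rw [quadFormula_of_nonpos (by linarith), sub_add_cancel]
  linarith

/-- If `y ∈ (-1, 0)`, the last point before `y` is eventually constant along the chains, so the
limit order has a maximum. -/
theorem exists_limitLE_max {x y : Set.Icc (-1 : ℝ) 1} (hx : (x : ℝ) = 1)
    (hy : (y : ℝ) ∈ Set.Ioo (-1 : ℝ) 0) {ε : ℕ → ℝ} {C : ∀ n, EpsChain quadMap (ε n) x y}
    (hC : OrdinatelyNested C) : ∃ m, ∀ w, limitLE C w m := by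
  obtain ⟨c, hyc, hc0, hc⟩ := exists_quadFormula_lt hy.1 hy.2
  obtain ⟨N, hN⟩ := hC.exists_lt (η := min 1 (min ((c - y) / 2) (y - quadFormula c)))
    (lt_min one_pos (lt_min (by linarith) (by linarith)))
  have hN1 : ∀ n ≥ N, ε n < 1 := fun n hn => (hN n hn).trans_le (min_le_left _ _)
  have hN2 : ∀ n ≥ N, ε n < (c - y) / 2 := fun n hn =>
    (hN n hn).trans_le ((min_le_right _ _).trans (min_le_left _ _))
  have hN3 : ∀ n ≥ N, ε n < y - quadFormula c := fun n hn =>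
    (hN n hn).trans_le ((min_le_right _ _).trans (min_le_right _ _))
  set p := fun n => (C n).pt ((C n).len - 1) with hp
  have hlen : ∀ n ≥ N, 1 < (C n).len := fun n hn => (C n).one_lt_len (hN1 n hn).le hx hy.2
  have hpne : ∀ n ≥ N, p n ∉ ({x, y} : Set _) := fun n hn =>
    (hC.acyclic n).penultimate_ne (hlen n hn)
  have hps : ∀ n, p n ∈ (C n).support := fun n => (C n).pt_mem_support (Nat.sub_le _ _)
  have hconst : ∀ n ≥ N, p n = p N := by
    intro n hn
    obtain ⟨i, hi0, hi, hip⟩ := EpsChain.exists_interior_index (hC.monotone_support hn (hps N))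
      (hpne N le_rfl)
    by_cases hi' : i = (C n).len - 1
    · rw [← hip, hi']
    -- If `p N` is not the penultimate point of chain `n`, its successor is near `quadFormula (p
    -- N)`, hence near `y` and below `c`. The chain is then trapped below `c`, and its penultimate
    -- point is sent at most to `quadFormula c < y - ε n`, too low to reach `y`.
    · exfalso
      have h1 := (C n).step i hi
      rw [hip, Subtype.dist_eq, Real.dist_eq] at h1
      have h2 := (abs_lt.1 h1).1
      change -ε n < quadFormula (p N) - (C n).pt (i + 1) at h2
      have h3 := (abs_lt.1 (C N).abs_quadFormula_penultimate_lt).2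
      change quadFormula (p N) - y < ε N at h3
      have h4 := (C n).le_of_le hc0.le (by linarith [hN3 n hn]) (by omega : i + 1 ≤ (C n).len - 1)
        (by omega) (by linarith [hN2 n hn, hN2 N le_rfl])
      have h5 := (abs_lt.1 (C n).abs_quadFormula_penultimate_lt).1
      have h6 := quadFormula_le_of_nonpos (p n).2.1 h4 hc0.le
      linarith [hN3 n hn]
  refine ⟨⟨p N, Set.mem_iUnion.2 ⟨N, hps N⟩, hpne N le_rfl⟩, ?_⟩
  rintro ⟨w, hw, hw'⟩
  obtain ⟨M, hM⟩ := Set.mem_iUnion.1 hw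
  refine ⟨max N M, fun n hn => ?_⟩
  obtain ⟨i, -, hi, hiw⟩ := EpsChain.exists_interior_index
    (hC.monotone_support ((le_max_right N M).trans hn) hM) hw'
  exact ⟨i, (C n).len - 1, by omega, Nat.sub_le _ _, hiw, hconst n ((le_max_left N M).trans hn)⟩

/-- If `y = -1`, the limit order has no maximum: late chains visit points of `(-1, 0)` that are
closer to `-1` than any given point. -/
theorem not_exists_limitLE_max {x y : Set.Icc (-1 : ℝ) 1} (hx : (x : ℝ) = 1)
    (hy : (y : ℝ) = -1) {ε : ℕ → ℝ} {C : ∀ n, EpsChain quadMap (ε n) x y}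
    (hC : OrdinatelyNested C) : ¬∃ m, ∀ w, limitLE C w m := by
  rintro ⟨⟨z, hz, hz'⟩, hmax⟩
  have hgt : ∀ w : Set.Icc (-1 : ℝ) 1, w ∉ ({x, y} : Set _) → -1 < (w : ℝ) := fun w hw =>
    lt_of_le_of_ne w.2.1 fun h => hw (.inr (Subtype.ext (h.symm.trans hy.symm)))
  have hfz := neg_one_lt_quadFormula (hgt z hz')
  obtain ⟨n, hn⟩ := hC.exists_lt (η := min 1 (quadFormula z + 1))
    (lt_min one_pos (by linarith))
  have hn1 := (hn n le_rfl).trans_le (min_le_left _ _)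
  have hn2 := (hn n le_rfl).trans_le (min_le_right _ _)
  set p := (C n).pt ((C n).len - 1)
  have hpne : p ∉ ({x, y} : Set _) :=
    (hC.acyclic n).penultimate_ne ((C n).one_lt_len hn1.le hx (by linarith))
  have hfp := (abs_lt.1 (C n).abs_quadFormula_penultimate_lt).2
  change quadFormula p - y < ε n at hfp
  have hp0 : (p : ℝ) < 0 := neg_of_quadFormula_neg (by linarith)
  -- The penultimate point `p` has its image within `ε n` of `-1`, hence below the image of `z`.
  -- Late chains cannot climb from `p` back to `z`, so `z` is not above `p` in the limit order.
  have hpz : (p : ℝ) < z := by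
    by_contra! h
    have := quadFormula_le_of_nonpos z.2.1 h hp0.le
    linarith
  obtain ⟨N, hN⟩ := hmax ⟨p, Set.mem_iUnion.2 ⟨n, (C n).pt_mem_support (Nat.sub_le _ _)⟩, hpne⟩
  obtain ⟨M, hM⟩ := hC.exists_lt (sub_pos.2 (quadFormula_lt_self (hgt p hpne) hp0))
  obtain ⟨i, j, hij, hj, hip, hjz⟩ := hN (max N M) (le_max_left _ _)
  have := (C (max N M)).le_of_le hp0.le (hM _ (le_max_right _ _)).le hij hj
    (congrArg Subtype.val hip).le
  rw [hjz] at this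
  exact this.not_gt hpz

theorem exists_max_of_mem_spectrum {x y : Set.Icc (-1 : ℝ) 1} (hx : (x : ℝ) = 1)
    (hy : (y : ℝ) ∈ Set.Ioo (-1 : ℝ) 0) {I : Type} [LinearOrder I]
    (h : OrderType.type I ∈ spectrum quadMap x y) : ∃ m : I, ∀ i, i ≤ m := by
  obtain ⟨ε, C, hC, ⟨e⟩⟩ := h
  obtain ⟨e'⟩ := OrderType.type_eq_type.1 (OrderType.type_toType (OrderType.type I))
  obtain ⟨m, hm⟩ := exists_limitLE_max hx hy hC
  refine ⟨e' (e m), fun i => ?_⟩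
  have := e.map_rel_iff.2 (hm (e.symm (e'.symm i)))
  rw [RelIso.apply_symm_apply] at this
  exact e'.symm_apply_le.1 this

theorem not_exists_max_of_mem_spectrum {x y : Set.Icc (-1 : ℝ) 1} (hx : (x : ℝ) = 1)
    (hy : (y : ℝ) = -1) {I : Type} [LinearOrder I]
    (h : OrderType.type I ∈ spectrum quadMap x y) : ¬∃ m : I, ∀ i, i ≤ m := by
  obtain ⟨ε, C, hC, ⟨e⟩⟩ := h
  obtain ⟨e'⟩ := OrderType.type_eq_type.1 (OrderType.type_toType (OrderType.type I))
  rintro ⟨m, hm⟩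
  refine not_exists_limitLE_max hx hy hC ⟨e.symm (e'.symm m), fun w => ?_⟩
  rw [← e.map_rel_iff, RelIso.apply_symm_apply]
  exact e'.le_symm_apply.2 (hm _)

theorem zeta_mul_omega_add_zeta_notMem {x y : Set.Icc (-1 : ℝ) 1} (hx : (x : ℝ) = 1)
    (hy : (y : ℝ) ∈ Set.Ioo (-1 : ℝ) 0) :
    zeta * omegaType + zeta ∉ spectrum quadMap x y := by
  rw [zeta, omegaType, ← OrderType.type_lex_prod, ← OrderType.type_lex_sum]
  intro h
  obtain ⟨m, hm⟩ := exists_max_of_mem_spectrum hx hy h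
  rcases m with p | j
  · exact Sum.Lex.not_inr_le_inl (hm (toLex (Sum.inr 0)))
  · have : j + 1 ≤ j := Sum.Lex.inr_le_inr_iff.1 (hm (toLex (Sum.inr (j + 1))))
    omega

theorem zeta_mul_omega_add_omegaStar_notMem {x y : Set.Icc (-1 : ℝ) 1} (hx : (x : ℝ) = 1)
    (hy : (y : ℝ) = -1) : zeta * omegaType + omegaStar ∉ spectrum quadMap x y := by
  rw [zeta, omegaType, omegaStar, ← OrderType.type_lex_prod, ← OrderType.type_lex_sum]
  intro h
  refine not_exists_max_of_mem_spectrum hx hy h ⟨toLex (Sum.inr (OrderDual.toDual 0)), ?_⟩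
  rintro (p | j)
  · exact Sum.Lex.inl_le_inr _ _
  · exact Sum.Lex.inr_le_inr_iff.2 (Nat.zero_le (OrderDual.ofDual j))

end Obstructions

/-! ### Prolongational sets of the map -/

section ProlongationsOfQuadMap

theorem mem_setImage {X : Type*} {R : X → Set X} {A : Set X} {a b : X} (ha : a ∈ A)
    (hb : b ∈ R a) : b ∈ setImage R A := Set.mem_biUnion ha hb

theorem prolongation_one_subset {X : Type*} [MetricSpace X] (f : X → X) {α : Ordinal.{0}}
    (hα : 1 < α) (x : X) : prolongation f 1 x ⊆ prolongation f α x := by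
  intro y hy
  rw [prolongation_of_ne_one f hα.ne']
  simp only [Set.mem_iInter]
  intro ε hε
  refine subset_closure ?_
  simp only [Set.mem_iUnion]
  exact ⟨1, le_rfl, 1, le_rfl, hα, mem_setImage (Metric.mem_ball_self hε) hy⟩

theorem iterate_orbit {X : Type*} {f : X → X} {q : ℤ → X} (hq : ∀ j, f (q j) = q (j + 1))
    (m : ℕ) (j : ℤ) : f^[m] (q j) = q (j + m) := by
  induction m generalizing j with
  | zero => simp
  | succ m ih =>
    rw [Function.iterate_succ_apply, hq, ih]
    congr 1
    push_cast
    ring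

/-- The orbit point `q (-n)` is close to `a` and reaches `q 0` in exactly `n` steps. -/
theorem nonWandering_apply_zero {X : Type*} [MetricSpace X] {f : X → X} {q : ℤ → X}
    (hq : ∀ j, f (q j) = q (j + 1)) {a : X}
    (ha : Filter.Tendsto (fun n : ℕ => q (-n)) Filter.atTop (nhds a)) :
    NonWandering f a (q 0) := by
  intro ε hε
  obtain ⟨n, h1, h2⟩ := ((ha.eventually (Metric.ball_mem_nhds a hε)).and
    (Filter.eventually_ge_atTop 1)).exists
  refine ⟨_, h1, n, h2, ?_⟩
  rw [iterate_orbit hq, neg_add_cancel]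
  exact Metric.mem_ball_self hε

theorem nonWandering_of_tendsto {X : Type*} [MetricSpace X] {f : X → X} {q : ℤ → X}
    (hq : ∀ j, f (q j) = q (j + 1)) {a b : X}
    (ha : Filter.Tendsto (fun n : ℕ => q (-n)) Filter.atTop (nhds a))
    (hb : Filter.Tendsto (fun n : ℕ => q n) Filter.atTop (nhds b)) : NonWandering f a b := by
  intro ε hε
  obtain ⟨n, ⟨h1, h2⟩, h3⟩ := (((ha.eventually (Metric.ball_mem_nhds a hε)).and
    (hb.eventually (Metric.ball_mem_nhds b hε))).and (Filter.eventually_ge_atTop 1)).exists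
  refine ⟨_, h1, n + n, by omega, ?_⟩
  rw [iterate_orbit hq]
  push_cast
  rw [neg_add_cancel_left]
  exact h2

theorem zpow_le_iterate_quadMap {k : ℤ} {z : Set.Icc (-1 : ℝ) 1} (hz : (2 : ℝ) ^ k ≤ z) (m : ℕ) :
    (2 : ℝ) ^ k ≤ (quadMap^[m] z : Set.Icc (-1 : ℝ) 1) := by
  induction m with
  | zero => exact hz
  | succ m ih =>
    rw [Function.iterate_succ_apply']
    exact zpow_le_quadFormula ih

theorem pos_of_nonWandering {x y : Set.Icc (-1 : ℝ) 1} (hx : 0 < (x : ℝ))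
    (h : NonWandering quadMap x y) : 0 < (y : ℝ) := by
  obtain ⟨k, hk, -⟩ := exists_dyadic (half_pos hx)
  refine lt_of_lt_of_le (by positivity : (0 : ℝ) < 2 ^ k) ?_
  by_contra! hy
  obtain ⟨z, hz, m, -, hm⟩ := h (min (x / 2) (2 ^ k - y)) (lt_min (half_pos hx) (sub_pos.2 hy))
  rw [Metric.mem_ball, Subtype.dist_eq, Real.dist_eq] at hz hm
  have h1 := (abs_lt.1 (hz.trans_le (min_le_left _ _))).1
  have h2 := (abs_lt.1 (hm.trans_le (min_le_right _ _))).2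
  have h3 := zpow_le_iterate_quadMap (z := z) (hk.trans (by linarith)) m
  linarith

theorem eq_one_of_lt_two {β : Ordinal.{0}} (h1 : 1 ≤ β) (h2 : β < 2) : β = 1 := by
  rw [← one_add_one_eq_two] at h2
  exact le_antisymm (Order.lt_add_one_iff.1 h2) h1

theorem eq_one_or_two_of_lt_three {β : Ordinal.{0}} (h1 : 1 ≤ β) (h3 : β < 3) :
    β = 1 ∨ β = 2 := by
  rw [← two_add_one_eq_three] at h3
  exact (Order.lt_add_one_iff.1 h3).lt_or_eq.imp_left (eq_one_of_lt_two h1)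

theorem nonneg_of_mem_prolongation_two {x y : Set.Icc (-1 : ℝ) 1} (hx : 0 < (x : ℝ))
    (h : y ∈ prolongation quadMap 2 x) : 0 ≤ (y : ℝ) := by
  rw [prolongation_of_ne_one quadMap (by norm_num)] at h
  simp only [Set.mem_iInter] at h
  -- The radius is `x` itself, so the ball contains only positive points; iterates of `J_1` keep
  -- them positive, and the closure adds at most `0`.
  refine closure_minimal ?_ (isClosed_le continuous_const continuous_subtype_val :
    IsClosed {y : Set.Icc (-1 : ℝ) 1 | 0 ≤ (y : ℝ)}) (h x hx)
  simp only [Set.iUnion_subset_iff]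
  intro n _ β h1 h2
  obtain rfl := eq_one_of_lt_two h1 h2
  have : ∀ n : ℕ, ∀ z ∈ (setImage (prolongation quadMap 1))^[n] (Metric.ball x x),
      0 < (z : ℝ) := by
    intro n
    induction n with
    | zero =>
      intro z hz
      rw [Function.iterate_zero, id, Metric.mem_ball, Subtype.dist_eq, Real.dist_eq] at hz
      linarith [(abs_lt.1 hz).1]
    | succ n ih =>
      intro z hz
      rw [Function.iterate_succ_apply'] at hz
      obtain ⟨w, hw, hz⟩ := Set.mem_iUnion₂.1 hz
      rw [prolongation_one] at hz
      exact pos_of_nonWandering (ih w hw) hz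
  exact fun z hz => (this n z hz).le

theorem zpow_neg_mem (k : ℕ) : (2 : ℝ) ^ (-(k : ℤ)) ∈ Set.Icc (-1 : ℝ) 1 := by
  have h : (0 : ℝ) < 2 ^ (-(k : ℤ)) := by positivity
  exact ⟨by linarith, zpow_le_one_of_nonpos₀ one_le_two (by omega)⟩

theorem nonWandering_zpow (k : ℕ) : NonWandering quadMap
    ⟨(2 : ℝ) ^ (-(k : ℤ)), zpow_neg_mem k⟩
    ⟨(2 : ℝ) ^ (-((k + 1 : ℕ) : ℤ)), zpow_neg_mem (k + 1)⟩ := by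
  have hmem : ∀ j, dyadicOrbit k j ∈ Set.Icc (-1 : ℝ) 1 := fun j =>
    have h0 : (0 : ℝ) < 2 ^ (-(k : ℤ) - 1) := by positivity
    ⟨by linarith [(dyadicOrbit_bounds k j).1],
      (dyadicOrbit_bounds k j).2.le.trans (zpow_neg_mem k).2⟩
  refine nonWandering_of_tendsto (q := fun j => ⟨dyadicOrbit k j, hmem j⟩)
    (fun j => Subtype.ext (quadFormula_dyadicOrbit k j)) ?_ ?_
  · rw [tendsto_subtype_rng]
    have := ((tendsto_squaringOrbit_neg_natCast half_pos_lt_one.1).const_add 1).const_mul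
      ((2 : ℝ) ^ (-(k : ℤ) - 1))
    rwa [one_add_one_eq_two, ← zpow_two_add_one, sub_add_cancel] at this
  · rw [tendsto_subtype_rng]
    have := ((tendsto_squaringOrbit_natCast half_pos_lt_one.1 half_pos_lt_one.2).const_add
      1).const_mul ((2 : ℝ) ^ (-(k : ℤ) - 1))
    rw [add_zero, mul_one] at this
    have hexp : -((k + 1 : ℕ) : ℤ) = -(k : ℤ) - 1 := by push_cast; ring
    change Filter.Tendsto _ _ (nhds ((2 : ℝ) ^ (-((k + 1 : ℕ) : ℤ))))
    rwa [hexp]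

/-- Each application of `J_1` descends one fixed point, so the `n`-th iterate contains `2 ^ (-n)`,
and the closure supplies the limit `0`. -/
theorem zero_mem_prolongation_two {x y : Set.Icc (-1 : ℝ) 1} (hx : (x : ℝ) = 1)
    (hy : (y : ℝ) = 0) : y ∈ prolongation quadMap 2 x := by
  rw [prolongation_of_ne_one quadMap (by norm_num)]
  simp only [Set.mem_iInter]
  intro ε hε
  have hiter : ∀ n : ℕ, (⟨(2 : ℝ) ^ (-(n : ℤ)), zpow_neg_mem n⟩ : Set.Icc (-1 : ℝ) 1) ∈
      (setImage (prolongation quadMap 1))^[n] (Metric.ball x ε) := by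
    intro n
    induction n with
    | zero =>
      rw [show (⟨(2 : ℝ) ^ (-((0 : ℕ) : ℤ)), zpow_neg_mem 0⟩ : Set.Icc (-1 : ℝ) 1) = x from
        Subtype.ext (by simp [hx])]
      exact Metric.mem_ball_self hε
    | succ n ih =>
      rw [Function.iterate_succ_apply']
      refine mem_setImage ih ?_
      rw [prolongation_one]
      exact nonWandering_zpow n
  have hlim : Filter.Tendsto
      (fun n : ℕ => (⟨(2 : ℝ) ^ (-(n : ℤ)), zpow_neg_mem n⟩ : Set.Icc (-1 : ℝ) 1))
      Filter.atTop (nhds y) := by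
    rw [tendsto_subtype_rng, hy]
    simpa using tendsto_pow_atTop_nhds_zero_of_lt_one (r := (2⁻¹ : ℝ)) (by norm_num) (by norm_num)
  refine mem_closure_of_tendsto hlim ?_
  filter_upwards [Filter.eventually_ge_atTop 1] with n hn
  simp only [Set.mem_iUnion]
  exact ⟨n, hn, 1, le_rfl, one_lt_two, hiter n⟩

theorem nonWandering_zero {x y : Set.Icc (-1 : ℝ) 1} (hx : (x : ℝ) = 0) (hy : (y : ℝ) < 0) :
    NonWandering quadMap x y := by
  have hmem : ∀ t : ℝ, 0 < t → t < 1 → ∀ j, squaringOrbit t j - 1 ∈ Set.Icc (-1 : ℝ) 1 :=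
    fun t h0 h1 j => ⟨by linarith [squaringOrbit_pos h0 j],
      by linarith [squaringOrbit_lt_one h0 h1 j]⟩
  -- The point `-1` is only a forward limit of an orbit leaving `0`; any other negative point has
  -- its own backward orbit tending to `0`.
  rcases y.2.1.eq_or_lt with h | h
  · obtain ⟨h0, h1⟩ := half_pos_lt_one
    refine nonWandering_of_tendsto (q := fun j => ⟨_, hmem _ h0 h1 j⟩)
      (fun j => Subtype.ext (quadFormula_squaringOrbit_sub_one h0 h1 j)) ?_ ?_
    · rw [tendsto_subtype_rng, hx]
      simpa using (tendsto_squaringOrbit_neg_natCast h0).sub_const 1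
    · rw [tendsto_subtype_rng, ← h]
      simpa using (tendsto_squaringOrbit_natCast h0 h1).sub_const 1
  · have h0 : (0 : ℝ) < y + 1 := by linarith
    have h1 : (y + 1 : ℝ) < 1 := by linarith
    have := nonWandering_apply_zero (f := quadMap) (q := fun j => ⟨_, hmem _ h0 h1 j⟩) (a := x)
      (fun j => Subtype.ext (quadFormula_squaringOrbit_sub_one h0 h1 j)) (by
        rw [tendsto_subtype_rng, hx]
        simpa using (tendsto_squaringOrbit_neg_natCast h0).sub_const 1)
    convert this using 1
    exact Subtype.ext (by simp [squaringOrbit_zero])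

theorem mem_prolongation_three {x y : Set.Icc (-1 : ℝ) 1} (hx : (x : ℝ) = 1) (hy : (y : ℝ) < 0) :
    y ∈ prolongation quadMap 3 x := by
  have h0 : (0 : ℝ) ∈ Set.Icc (-1 : ℝ) 1 := by norm_num
  rw [prolongation_of_ne_one quadMap (by norm_num)]
  simp only [Set.mem_iInter]
  intro ε hε
  refine subset_closure ?_
  simp only [Set.mem_iUnion]
  -- Two iterates of the same `J_2`: from `1` to `0`, then from `0` to `y`, where `J_1 ⊆ J_2` is
  -- used.
  refine ⟨2, one_le_two, 2, one_le_two, by norm_num, ?_⟩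
  have hy1 : y ∈ prolongation quadMap 1 ⟨0, h0⟩ := by
    rw [prolongation_one]
    exact nonWandering_zero rfl hy
  exact mem_setImage (mem_setImage (Metric.mem_ball_self hε) (zero_mem_prolongation_two hx rfl))
    (prolongation_one_subset quadMap one_lt_two _ hy1)

theorem notMem_prolongation_two {x y : Set.Icc (-1 : ℝ) 1} (hx : (x : ℝ) = 1)
    (hy : (y : ℝ) < 0) : y ∉ prolongation quadMap 2 x := fun h =>
  (nonneg_of_mem_prolongation_two (by rw [hx]; exact one_pos) h).not_gt hy

theorem isLeast_prolongation_three {x y : Set.Icc (-1 : ℝ) 1} (hx : (x : ℝ) = 1)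
    (hy : (y : ℝ) < 0) :
    IsLeast {β : Ordinal.{0} | 1 ≤ β ∧ y ∈ prolongation quadMap β x} 3 := by
  refine ⟨⟨by norm_num, mem_prolongation_three hx hy⟩, ?_⟩
  rintro β ⟨h1, hβ⟩
  by_contra! h3
  refine notMem_prolongation_two hx hy ?_
  rcases eq_one_or_two_of_lt_three h1 h3 with rfl | rfl
  · exact prolongation_one_subset quadMap one_lt_two x hβ
  · exact hβ

theorem spectrum_ne_spectrum {x₁ x₂ x₃ : Set.Icc (-1 : ℝ) 1} (h₁ : (x₁ : ℝ) = 1)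
    (h₂ : (x₂ : ℝ) = -1) (h₃ : (x₃ : ℝ) ∈ Set.Ioo (-1 : ℝ) 0) :
    spectrum quadMap x₁ x₂ ≠ spectrum quadMap x₁ x₃ := fun h =>
  zeta_mul_omega_add_zeta_notMem h₁ h₃ (h ▸ zeta_mul_omega_add_zeta_mem h₁ h₂)

end ProlongationsOfQuadMap

end EOS

theorem mainTheorem12 :
    (∃ (X : Type) (_ : MetricSpace X) (_ : CompactSpace X) (f : X → X) (x₁ x₂ x₃ : X)
      (α : Ordinal.{0}),
      Continuous f ∧
      IsLeast {β : Ordinal.{0} | 1 ≤ β ∧ x₂ ∈ EOS.prolongation f β x₁} α ∧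
      IsLeast {β : Ordinal.{0} | 1 ≤ β ∧ x₃ ∈ EOS.prolongation f β x₁} α ∧
      EOS.spectrum f x₁ x₂ ≠ EOS.spectrum f x₁ x₃) ∧
    (Continuous EOS.quadMap ∧
      ∀ x₁ x₂ x₃ : Set.Icc (-1 : ℝ) 1, (x₁ : ℝ) = 1 → (x₂ : ℝ) = -1 →
        (x₃ : ℝ) ∈ Set.Ioo (-1 : ℝ) 0 →
        x₂ ∈ EOS.prolongation EOS.quadMap 3 x₁ \ EOS.prolongation EOS.quadMap 2 x₁ ∧
        x₃ ∈ EOS.prolongation EOS.quadMap 3 x₁ \ EOS.prolongation EOS.quadMap 2 x₁ ∧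
        IsLeast {β : Ordinal.{0} | 1 ≤ β ∧ x₂ ∈ EOS.prolongation EOS.quadMap β x₁} 3 ∧
        IsLeast {β : Ordinal.{0} | 1 ≤ β ∧ x₃ ∈ EOS.prolongation EOS.quadMap β x₁} 3 ∧
        EOS.zeta * EOS.omegaType + EOS.zeta ∈
          EOS.spectrum EOS.quadMap x₁ x₂ \ EOS.spectrum EOS.quadMap x₁ x₃ ∧
        EOS.zeta * EOS.omegaType + EOS.omegaStar ∈
          EOS.spectrum EOS.quadMap x₁ x₃ \ EOS.spectrum EOS.quadMap x₁ x₂ ∧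
        EOS.spectrum EOS.quadMap x₁ x₂ ≠ EOS.spectrum EOS.quadMap x₁ x₃) := by
  refine ⟨⟨Set.Icc (-1 : ℝ) 1, inferInstance, inferInstance, EOS.quadMap, ⟨1, by norm_num⟩,
    ⟨-1, by norm_num⟩, ⟨-1 / 2, by norm_num⟩, 3, EOS.continuous_quadMap,
    EOS.isLeast_prolongation_three rfl (by norm_num),
    EOS.isLeast_prolongation_three rfl (by norm_num),
    EOS.spectrum_ne_spectrum rfl rfl (by norm_num)⟩, EOS.continuous_quadMap, ?_⟩
  intro x₁ x₂ x₃ h₁ h₂ h₃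
  have h₂' : (x₂ : ℝ) < 0 := by linarith
  exact ⟨⟨EOS.mem_prolongation_three h₁ h₂', EOS.notMem_prolongation_two h₁ h₂'⟩,
    ⟨EOS.mem_prolongation_three h₁ h₃.2, EOS.notMem_prolongation_two h₁ h₃.2⟩,
    EOS.isLeast_prolongation_three h₁ h₂', EOS.isLeast_prolongation_three h₁ h₃.2,
    ⟨EOS.zeta_mul_omega_add_zeta_mem h₁ h₂, EOS.zeta_mul_omega_add_zeta_notMem h₁ h₃⟩,
    ⟨EOS.zeta_mul_omega_add_omegaStar_mem h₁ h₃,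
      EOS.zeta_mul_omega_add_omegaStar_notMem h₁ h₂⟩,
    EOS.spectrum_ne_spectrum h₁ h₂ h₃⟩
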